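/- Let $\mathbb{R}^\infty$ (respectively $\mathbb{Z}^\infty$) be the set of sequences $u=(u_1,u_2,\dots)$ of real numbers (respectively integers) with only finitely many nonzero entries, and let $\mathbb{R}^\infty_{\ge 0}\subseteq\mathbb{R}^\infty$ be the set of those with all entries nonnegative. Let $\mathrm{Sym}=\mathrm{Sym}(\infty)$ be the group of permutations of $\mathbb{N}=\{1,2,\dots\}$ that fix all but finitely many elements, acting on sequences by $\sigma(u)=(u_{\sigma^{-1}(1)},u_{\sigma^{-1}(2)},\dots)$, and for a set $A$ of sequences put $\mathrm{Sym}(A)=\{\sigma(u)\mid \sigma\in\mathrm{Sym},\ u\in A\}$. A cone $C\subseteq\mathbb{R}^\infty$ is called rational if it is generated, as a cone, by (possibly infinitely many) elements with rational coordinates. It is called $\mathrm{Sym}$-equivariantly finitely generated if there is a finite set $A\subseteq\mathbb{R}^\infty$ such that $C$ is the cone generated by $\mathrm{Sym}(A)$, i.e. the set of all finite linear combinations of elements of $\mathrm{Sym}(A)$ with nonnegative real coefficients. A monoid (additive submonoid) $M\subseteq\mathbb{Z}^\infty$ is called $\mathrm{Sym}$-equivariantly finitely generated if there is a finite set $A\subseteq\mathbb{Z}^\infty$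 such that $M$ is the monoid generated by $\mathrm{Sym}(A)$. The monoid $M$ is called normal if $M=\{u\in\mathbb{Z}^{\mathbb{N}}\mid ku\in M\text{ for some integer }k\ge 1\}$. **Theorem (equivariant Gordan's lemma).** Let $C\subseteq\mathbb{R}^\infty_{\ge 0}$ be a $\mathrm{Sym}$-equivariantly finitely generated rational cone. Then $M=C\cap\mathbb{Z}^\infty$ is a $\mathrm{Sym}$-equivariantly finitely generated normal monoid. -/

import Mathlib

/-- `Sym(∞)`: the group of permutations of the index set that fix all but finitely many indices.
(Coordinates are indexed by `ℕ`, starting from `0`.) -/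
def SymInf : Subgroup (Equiv.Perm ℕ) where
  carrier := {σ | {i | σ i ≠ i}.Finite}
  one_mem' := by simp
  mul_mem' := by
    intro σ τ hσ hτ
    refine (Set.Finite.union hσ hτ).subset fun i hi => ?_
    by_contra h
    simp only [Set.mem_union, Set.mem_ofPred_eq, not_or, not_not] at h
    exact hi (by rw [Equiv.Perm.mul_apply, h.2, h.1])
  inv_mem' := by
    intro σ hσ
    refine Set.Finite.subset hσ fun i hi h => hi ?_
    rw [Equiv.Perm.inv_eq_iff_eq, h]

/-- `R^∞`: the sequences in `R^ℕ` of finite support. -/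
def FinSuppSeq (R : Type*) [AddMonoid R] : AddSubmonoid (ℕ → R) where
  carrier := {u | (Function.support u).Finite}
  zero_mem' := by simp
  add_mem' := fun hu hv => (Set.Finite.union hu hv).subset (Function.support_add _ _)

/-- The action `σ(u) = (u_{σ⁻¹(i)})_i` of permutations on sequences. -/
def permSeq {R : Type*} (σ : Equiv.Perm ℕ) (u : ℕ → R) : ℕ → R := fun i => u (σ⁻¹ i)

/-- `Sym(A) = {σ(u) | σ ∈ Sym(∞), u ∈ A}`. -/
def symOrbit {R : Type*} (A : Set (ℕ → R)) : Set (ℕ → R) :=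
  {v | ∃ σ ∈ SymInf, ∃ u ∈ A, v = permSeq σ u}

/-- A cone is `Sym`-equivariantly finitely generated if it is the cone generated by `Sym(A)` for
some finite set `A ⊆ ℝ^∞`. -/
def ConeSymFG (C : PointedCone ℝ (ℕ → ℝ)) : Prop :=
  ∃ A : Set (ℕ → ℝ), A.Finite ∧ A ⊆ FinSuppSeq ℝ ∧ C = PointedCone.hull ℝ (symOrbit A)

/-- A cone is rational if it is generated by elements with rational coordinates. -/
def ConeRational (C : PointedCone ℝ (ℕ → ℝ)) : Prop :=
  ∃ B : Set (ℕ → ℝ), (∀ b ∈ B, ∀ i, ∃ q : ℚ, b i = (q : ℝ)) ∧ C = PointedCone.hull ℝ B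

/-- A monoid in `ℤ^ℕ` is `Sym`-equivariantly finitely generated if it is the monoid generated by
`Sym(A)` for some finite set `A ⊆ ℤ^∞`. -/
def MonoidSymFG (M : AddSubmonoid (ℕ → ℤ)) : Prop :=
  ∃ A : Set (ℕ → ℤ), A.Finite ∧ A ⊆ FinSuppSeq ℤ ∧ M = AddSubmonoid.closure (symOrbit A)

/-- The normalization `{u ∈ ℤ^ℕ | k u ∈ M for some integer k ≥ 1}` of a monoid `M ⊆ ℤ^ℕ`. -/
def normalization (M : AddSubmonoid (ℕ → ℤ)) : Set (ℕ → ℤ) :=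
  {u | ∃ k : ℕ, 1 ≤ k ∧ k • u ∈ M}

/-- A monoid `M ⊆ ℤ^ℕ` is normal if it equals its normalization. -/
def MonoidNormal (M : AddSubmonoid (ℕ → ℤ)) : Prop :=
  (M : Set (ℕ → ℤ)) = normalization M

/-- The inclusion of `ℤ^ℕ` into `ℝ^ℕ`. -/
def intSeqToReal : (ℕ → ℤ) →+ (ℕ → ℝ) where
  toFun u := fun i => (u i : ℝ)
  map_zero' := by ext; simp
  map_add' := by intros; ext; simp

/-- The monoid `C ∩ ℤ^∞`. -/
def latticePoints (C : PointedCone ℝ (ℕ → ℝ)) : AddSubmonoid (ℕ → ℤ) :=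
  C.toAddSubmonoid.comap intSeqToReal ⊓ FinSuppSeq ℤ

/-!
Every element of `C` is majorized by an element `b` of the cone generated by the antitone
rearrangements of the generators, and conversely (Rado) a nonnegative sequence majorized by an
element of `C` lies in `C`. Since `b` vanishes from a fixed index `n` on, an element of `C` with
more than `2 * n` nonzero entries stays majorized by `b` when its two smallest nonzero entries are
merged into one. On lattice points this merging is undone by unit transfers, and these preserve the
monoid generated by the lattice points whose coordinate sum is at most `L`. It thus suffices to
generate the lattice points of bounded support, where Gordan's classical argument applies. Up to
`Sym`, only finitely many lattice points have coordinate sum at most `L`.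
-/

open Finset Filter

/-! ### Sequences and permutations of finite support -/

theorem swap_mem_symInf (i j : ℕ) : Equiv.swap i j ∈ SymInf :=
  (Set.toFinite {i, j}).subset fun l hl => by
    by_contra! h
    simp only [Set.mem_insert_iff, Set.mem_singleton_iff, not_or] at h
    exact hl (Equiv.swap_apply_of_ne_of_ne h.1 h.2)

theorem exists_forall_ge_apply_eq_of_mem_symInf {σ : Equiv.Perm ℕ} (hσ : σ ∈ SymInf) :
    ∃ N, ∀ i ≥ N, σ i = i := by
  obtain ⟨N, hN⟩ := Set.Finite.bddAbove (show {i | σ i ≠ i}.Finite from hσ)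
  refine ⟨N + 1, fun i hi => ?_⟩
  by_contra h
  have : i ≤ N := hN h
  omega

theorem permSeq_permSeq {R : Type*} (σ τ : Equiv.Perm ℕ) (u : ℕ → R) :
    permSeq σ (permSeq τ u) = permSeq (σ * τ) u := by
  ext i
  simp [permSeq]

theorem permSeq_one {R : Type*} (u : ℕ → R) : permSeq 1 u = u := rfl

theorem permSeq_inv_permSeq {R : Type*} (σ : Equiv.Perm ℕ) (u : ℕ → R) :
    permSeq σ⁻¹ (permSeq σ u) = u := by
  rw [permSeq_permSeq, inv_mul_cancel, permSeq_one]

theorem sum_permSeq {R : Type*} [AddCommMonoid R] (σ : Equiv.Perm ℕ) (u : ℕ → R)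
    (F : Finset ℕ) : ∑ i ∈ F, permSeq σ u i = ∑ i ∈ F.map (σ⁻¹).toEmbedding, u i :=
  (sum_map F (σ⁻¹).toEmbedding u).symm

theorem exists_forall_ge_eq_zero_of_mem_finSuppSeq {R : Type*} [AddMonoid R] {u : ℕ → R}
    (hu : u ∈ FinSuppSeq R) : ∃ N, ∀ i ≥ N, u i = 0 := by
  obtain ⟨N, hN⟩ := Set.Finite.bddAbove (show (Function.support u).Finite from hu)
  refine ⟨N + 1, fun i hi => ?_⟩
  by_contra h
  have : i ≤ N := hN h
  omega

theorem mem_finSuppSeq_of_forall_ge_eq_zero {R : Type*} [AddMonoid R] {u : ℕ → R} {N : ℕ}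
    (hu : ∀ i ≥ N, u i = 0) : u ∈ FinSuppSeq R :=
  (Set.finite_lt_nat N).subset fun i hi => not_le.1 fun h => hi (hu i h)

theorem permSeq_mem_finSuppSeq {R : Type*} [AddMonoid R] {u : ℕ → R} (hu : u ∈ FinSuppSeq R)
    (σ : Equiv.Perm ℕ) : permSeq σ u ∈ FinSuppSeq R :=
  Set.Finite.preimage (σ⁻¹.injective.injOn) hu

theorem exists_symInf_antitone_permSeq {R : Type*} [AddMonoid R] [LinearOrder R] {u : ℕ → R}
    (hu : u ∈ FinSuppSeq R) (hnonneg : ∀ i, 0 ≤ u i) :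
    ∃ σ ∈ SymInf, Antitone (permSeq σ u) := by
  obtain ⟨N, hN⟩ := exists_forall_ge_eq_zero_of_mem_finSuppSeq hu
  let τ : Equiv.Perm (Fin N) := Tuple.sort fun i => OrderDual.toDual (u i)
  have hτ : Antitone fun i => u (τ i) := Tuple.monotone_sort fun i => OrderDual.toDual (u i)
  let σ : Equiv.Perm ℕ := τ.extendDomain Fin.equivSubtype
  have σ_lt (i : ℕ) (hi : i < N) : σ i = τ ⟨i, hi⟩ :=
    τ.extendDomain_apply_image Fin.equivSubtype ⟨i, hi⟩
  have σ_ge (i : ℕ) (hi : N ≤ i) : σ i = i :=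
    τ.extendDomain_apply_not_subtype Fin.equivSubtype hi.not_gt
  have hσ : σ ∈ SymInf :=
    (Set.finite_lt_nat N).subset fun i hi => not_le.1 fun h => hi (σ_ge i h)
  refine ⟨σ⁻¹, inv_mem hσ, fun i j hij => ?_⟩
  change u (σ j) ≤ u (σ i)
  rcases lt_or_ge j N with hj | hj
  · rw [σ_lt i (hij.trans_lt hj), σ_lt j hj]
    exact hτ hij
  · rw [σ_ge j hj, hN j hj]
    exact hnonneg _

theorem exists_forall_ge_eq_zero_of_finite {R : Type*} [AddMonoid R] {Z : Set (ℕ → R)}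
    (hZ : Z.Finite) (hZfin : Z ⊆ FinSuppSeq R) : ∃ n, ∀ z ∈ Z, ∀ l ≥ n, z l = 0 := by
  have h : ∀ z ∈ Z, ∃ n, ∀ l ≥ n, z l = 0 := fun z hz =>
    exists_forall_ge_eq_zero_of_mem_finSuppSeq (hZfin hz)
  choose! n hn using h
  obtain ⟨N, hN⟩ := (hZ.image n).bddAbove
  exact ⟨N, fun z hz l hl => hn z hz l ((hN ⟨z, hz, rfl⟩).trans hl)⟩

theorem finite_setOf_forall_ge_eq_zero {R : Type*} [Zero R] {V : Set R} (hV : V.Finite) (K : ℕ) :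
    {g : ℕ → R | (∀ l, g l ∈ V) ∧ ∀ l ≥ K, g l = 0}.Finite := by
  refine Set.Finite.of_injOn (f := fun g (l : Fin K) => g l) (t := {f : Fin K → R | ∀ l, f l ∈ V})
    (fun g hg l => hg.1 l) (fun g hg h hh hgh => ?_) (Set.Finite.pi' fun _ => hV)
  ext l
  rcases lt_or_ge l K with hl | hl
  · exact congrFun hgh ⟨l, hl⟩
  · rw [hg.2 l hl, hh.2 l hl]

theorem ncard_support_permSeq {R : Type*} [Zero R] (σ : Equiv.Perm ℕ) (u : ℕ → R) :
    (Function.support (permSeq σ u)).ncard = (Function.support u).ncard :=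
  congrArg ENat.toNat (Set.encard_preimage_of_bijective σ⁻¹.bijective (Function.support u))

theorem eq_zero_of_antitone_of_ncard_support_le {R : Type*} [Zero R] [PartialOrder R]
    {u : ℕ → R} (hu : Antitone u) (hnonneg : ∀ i, 0 ≤ u i) (hfin : (Function.support u).Finite)
    {K : ℕ} (hK : (Function.support u).ncard ≤ K) {l : ℕ} (hl : K ≤ l) : u l = 0 := by
  by_contra h
  have hsub : (range (l + 1) : Set ℕ) ⊆ Function.support u := fun i hi =>
    (((hnonneg l).lt_of_ne' h).trans_le (hu (Nat.lt_succ_iff.1 (mem_range.1 hi)))).ne'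
  have := Set.ncard_le_ncard hsub hfin
  rw [Set.ncard_coe_finset, card_range] at this
  omega

/-- A set of sequences that is stable under all permutations of finite support. -/
def SymInvariant {R : Type*} (S : Set (ℕ → R)) : Prop :=
  ∀ σ ∈ SymInf, ∀ u ∈ S, permSeq σ u ∈ S

theorem SymInvariant.permSeq_mem_iff {R : Type*} {S : Set (ℕ → R)} (hS : SymInvariant S)
    {σ : Equiv.Perm ℕ} (hσ : σ ∈ SymInf) {u : ℕ → R} : permSeq σ u ∈ S ↔ u ∈ S := by
  refine ⟨fun h => ?_, hS σ hσ u⟩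
  rw [← permSeq_inv_permSeq σ u]
  exact hS _ (inv_mem hσ) _ h

theorem symInvariant_symOrbit {R : Type*} (A : Set (ℕ → R)) : SymInvariant (symOrbit A) := by
  rintro σ hσ _ ⟨τ, hτ, a, ha, rfl⟩
  exact ⟨σ * τ, mul_mem hσ hτ, a, ha, permSeq_permSeq σ τ a⟩

theorem subset_symOrbit {R : Type*} (A : Set (ℕ → R)) : A ⊆ symOrbit A :=
  fun a ha => ⟨1, one_mem _, a, ha, rfl⟩

theorem SymInvariant.symOrbit_subset_iff {R : Type*} {S A : Set (ℕ → R)} (hS : SymInvariant S) :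
    symOrbit A ⊆ S ↔ A ⊆ S := by
  refine ⟨(subset_symOrbit A).trans, ?_⟩
  rintro h _ ⟨σ, hσ, a, ha, rfl⟩
  exact hS σ hσ a (h ha)

theorem symInvariant_closure {R : Type*} [AddMonoid R] {A : Set (ℕ → R)} (hA : SymInvariant A) :
    SymInvariant (AddSubmonoid.closure A : Set (ℕ → R)) := by
  intro σ hσ u hu
  induction hu using AddSubmonoid.closure_induction with
  | mem x hx => exact AddSubmonoid.subset_closure (hA σ hσ x hx)
  | zero => exact zero_mem (AddSubmonoid.closure A)
  | add x y _ _ hx hy => exact add_mem hx hy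

theorem finite_setOf_mem_symOrbit_forall_ge_eq_zero {R : Type*} [AddMonoid R] {Z : Set (ℕ → R)}
    (hZ : Z.Finite) (hZfin : Z ⊆ FinSuppSeq R) (K : ℕ) :
    {x ∈ symOrbit Z | ∀ l ≥ K, x l = 0}.Finite := by
  have hV : (⋃ z ∈ Z, Set.range z).Finite := by
    refine hZ.biUnion fun z hz => ((hZfin hz).image z |>.insert 0).subset ?_
    rintro _ ⟨l, rfl⟩
    by_cases hl : z l = 0
    · exact Or.inl hl
    · exact Or.inr ⟨l, hl, rfl⟩
  refine (finite_setOf_forall_ge_eq_zero hV K).subset ?_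
  rintro _ ⟨⟨σ, -, z, hz, rfl⟩, hx⟩
  exact ⟨fun l => Set.mem_biUnion hz ⟨σ⁻¹ l, rfl⟩, hx⟩

/-! ### Transfers -/

/-- The sequence obtained from `u` by moving the amount `t` from entry `i` to entry `j`. -/
def transfer {R : Type*} [AddCommGroup R] (u : ℕ → R) (i j : ℕ) (t : R) : ℕ → R :=
  u + (Pi.single j t - Pi.single i t)

section Transfer

variable {R : Type*} [AddCommGroup R]

theorem transfer_apply (u : ℕ → R) (i j : ℕ) (t : R) (l : ℕ) :
    transfer u i j t l = u l + ((if l = j then t else 0) - if l = i then t else 0) := by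
  simp [transfer, Pi.single_apply]

theorem sum_transfer (u : ℕ → R) (i j : ℕ) (t : R) (F : Finset ℕ) :
    ∑ l ∈ F, transfer u i j t l =
      ∑ l ∈ F, u l + ((if j ∈ F then t else 0) - if i ∈ F then t else 0) := by
  simp only [transfer_apply, sum_add_distrib, sum_sub_distrib, sum_ite_eq']

theorem transfer_transfer (u : ℕ → R) (i j : ℕ) (s t : R) :
    transfer (transfer u i j s) i j t = transfer u i j (s + t) := by
  simp only [transfer, Pi.single_add]
  abel

theorem transfer_transfer_symm (u : ℕ → R) (i j : ℕ) (t : R) :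
    transfer (transfer u i j t) j i t = u := by
  simp only [transfer]
  abel

theorem permSeq_swap (u : ℕ → R) (i j : ℕ) :
    permSeq (Equiv.swap i j) u = transfer u i j (u i - u j) := by
  ext l
  rw [transfer_apply, permSeq, Equiv.swap_inv, Equiv.swap_apply_def]
  split_ifs <;> simp_all

theorem transfer_mem_finSuppSeq {u : ℕ → R} (hu : u ∈ FinSuppSeq R) (i j : ℕ) (t : R) :
    transfer u i j t ∈ FinSuppSeq R := by
  refine (Set.Finite.union hu (Set.toFinite {i, j})).subset fun l hl => ?_
  contrapose! hl
  simp_all [transfer_apply]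

end Transfer

/-! ### Cones of sequences -/

theorem antitone_of_mem_hull {R : Type*} [Semiring R] [PartialOrder R] [IsOrderedRing R]
    {A : Set (ℕ → R)} (hA : ∀ a ∈ A, Antitone a) {b : ℕ → R} (hb : b ∈ PointedCone.hull R A) :
    Antitone b := by
  induction hb using Submodule.span_induction with
  | mem x hx => exact hA x hx
  | zero => exact antitone_const
  | add x y _ _ hx hy => exact hx.add hy
  | smul c x _ hx => exact hx.const_smul c.2

theorem eq_zero_of_mem_hull {R : Type*} [Semiring R] [PartialOrder R] [IsOrderedRing R]
    {A : Set (ℕ → R)} {i : ℕ} (hA : ∀ a ∈ A, a i = 0) {b : ℕ → R}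
    (hb : b ∈ PointedCone.hull R A) : b i = 0 := by
  induction hb using Submodule.span_induction with
  | mem x hx => exact hA x hx
  | zero => rfl
  | add x y _ _ hx hy => simp [hx, hy]
  | smul c x _ hx => simp [hx]

theorem mem_hull_setOf_eq_zero {R : Type*} [Semiring R] [PartialOrder R] [IsOrderedRing R]
    [NoZeroDivisors R] {S : Set (ℕ → R)} (hS : ∀ x ∈ S, ∀ i, 0 ≤ x i) {I : Set ℕ}
    {u : ℕ → R} (hu : u ∈ PointedCone.hull R S) (huI : ∀ i ∈ I, u i = 0) :
    u ∈ PointedCone.hull R {x ∈ S | ∀ i ∈ I, x i = 0} := by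
  suffices h : (∀ i, 0 ≤ u i) ∧
      ((∀ i ∈ I, u i = 0) → u ∈ PointedCone.hull R {x ∈ S | ∀ i ∈ I, x i = 0}) from h.2 huI
  clear huI
  induction hu using Submodule.span_induction with
  | mem x hx => exact ⟨hS x hx, fun hxI => PointedCone.subset_hull ⟨hx, hxI⟩⟩
  | zero => exact ⟨fun _ => le_rfl, fun _ => zero_mem _⟩
  | add x y _ _ hx hy =>
    refine ⟨fun i => add_nonneg (hx.1 i) (hy.1 i), fun h => ?_⟩
    have hxy i (hi : i ∈ I) := (add_eq_zero_iff_of_nonneg (hx.1 i) (hy.1 i)).1 (h i hi)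
    exact add_mem (hx.2 fun i hi => (hxy i hi).1) (hy.2 fun i hi => (hxy i hi).2)
  | smul c x _ hx =>
    refine ⟨fun i => mul_nonneg c.2 (hx.1 i), fun h => ?_⟩
    rcases eq_or_ne c 0 with rfl | hc
    · rw [zero_smul]
      exact zero_mem _
    · exact Submodule.smul_mem _ c
        (hx.2 fun i hi => (mul_eq_zero.1 (h i hi)).resolve_left (Subtype.coe_ne_coe.2 hc))

theorem symInvariant_hull_symOrbit {R : Type*} [Semiring R] [PartialOrder R] [IsOrderedRing R]
    (A : Set (ℕ → R)) : SymInvariant (PointedCone.hull R (symOrbit A) : Set (ℕ → R)) := by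
  intro σ hσ u hu
  induction hu using Submodule.span_induction with
  | mem x hx => exact PointedCone.subset_hull (symInvariant_symOrbit A σ hσ x hx)
  | zero => exact zero_mem (PointedCone.hull R (symOrbit A))
  | add x y _ _ hx hy => exact add_mem hx hy
  | smul c x _ hx => exact Submodule.smul_mem (PointedCone.hull R (symOrbit A)) c hx

theorem SymInvariant.hull_symOrbit_le_iff {R : Type*} [Semiring R] [PartialOrder R]
    [IsOrderedRing R] {A : Set (ℕ → R)} {C : PointedCone R (ℕ → R)}
    (hC : SymInvariant (C : Set (ℕ → R))) : PointedCone.hull R (symOrbit A) ≤ C ↔ A ⊆ C :=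
  Submodule.span_le.trans hC.symOrbit_subset_iff

theorem transfer_mem_of_symInvariant {R : Type*} [Field R] [LinearOrder R]
    [IsStrictOrderedRing R] {C : PointedCone R (ℕ → R)}
    (hC : SymInvariant (C : Set (ℕ → R))) {u : ℕ → R} (hu : u ∈ C) {i j : ℕ} {t : R}
    (ht : 0 ≤ t) (htu : t ≤ u i - u j) : transfer u i j t ∈ C := by
  have hd : 0 ≤ u i - u j := ht.trans htu
  obtain ⟨r, hr0, hr1, rfl⟩ : ∃ r, 0 ≤ r ∧ r ≤ 1 ∧ t = r * (u i - u j) :=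
    ⟨t / (u i - u j), div_nonneg ht hd, div_le_one_of_le₀ htu hd,
      (div_mul_cancel_of_imp fun h => le_antisymm (h ▸ htu) ht).symm⟩
  have hcomb : transfer u i j (r * (u i - u j)) =
      (1 - r) • u + r • permSeq (Equiv.swap i j) u := by
    ext l
    simp only [permSeq_swap, transfer_apply, Pi.add_apply, Pi.smul_apply, smul_eq_mul]
    split_ifs <;> ring
  rw [hcomb]
  exact add_mem (C.smul_mem (sub_nonneg.2 hr1) hu)
    (C.smul_mem hr0 (hC _ (swap_mem_symInf i j) u hu))

/-! ### Majorization -/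

theorem nonneg_of_antitone {R : Type*} [Zero R] [Preorder R] {b : ℕ → R} {n : ℕ}
    (hb : Antitone b) (hbn : ∀ i ≥ n, b i = 0) (i : ℕ) : 0 ≤ b i := by
  rw [← hbn (max i n) (le_max_right i n)]
  exact hb (le_max_left i n)

theorem sum_le_sum_range_card_of_antitone {R : Type*} [AddCommMonoid R] [PartialOrder R]
    [IsOrderedAddMonoid R] {b : ℕ → R} (hb : Antitone b) (F : Finset ℕ) :
    ∑ i ∈ F, b i ≤ ∑ i ∈ range F.card, b i := by
  induction F using Finset.induction_on_max with
  | empty => simp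
  | insert m F hm ih =>
    have hcard : F.card ≤ m := by
      simpa using card_le_card fun i hi => mem_range.2 (hm i hi)
    have hmF : m ∉ F := fun h => (hm m h).false
    rw [sum_insert hmF, card_insert_of_notMem hmF, sum_range_succ, add_comm]
    exact add_le_add ih (hb hcard)

theorem sum_le_sum_range_of_forall_ge_eq_zero {R : Type*} [AddCommMonoid R] [PartialOrder R]
    [IsOrderedAddMonoid R] {b : ℕ → R} {n : ℕ} (hb : ∀ i, 0 ≤ b i) (hbn : ∀ i ≥ n, b i = 0)
    (F : Finset ℕ) : ∑ i ∈ F, b i ≤ ∑ i ∈ range n, b i := by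
  rw [← sum_filter_of_ne (p := (· < n)) fun i _ hi => not_le.1 fun h => hi (hbn i h)]
  exact sum_le_sum_of_subset_of_nonneg (fun i hi => mem_range.2 (mem_filter.1 hi).2)
    fun i _ _ => hb i

theorem eventually_sum_range_permSeq {R : Type*} [AddCommMonoid R] {σ : Equiv.Perm ℕ}
    (hσ : σ ∈ SymInf) (u : ℕ → R) :
    ∀ᶠ n in atTop, ∑ i ∈ range n, permSeq σ u i = ∑ i ∈ range n, u i := by
  obtain ⟨N, hN⟩ := exists_forall_ge_apply_eq_of_mem_symInf (inv_mem hσ)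
  filter_upwards [eventually_ge_atTop N] with n hn
  refine Equiv.Perm.sum_comp σ⁻¹ (range n) u fun i hi => ?_
  by_contra h
  exact hi (hN i (hn.trans (by simpa using h)))

theorem eventually_sum_range_transfer {R : Type*} [AddCommGroup R] (u : ℕ → R) (i j : ℕ) (t : R) :
    ∀ᶠ n in atTop, ∑ l ∈ range n, transfer u i j t l = ∑ l ∈ range n, u l := by
  filter_upwards [eventually_gt_atTop i, eventually_gt_atTop j] with n hi hj
  simp [sum_transfer, hi, hj]

/-- `b` majorizes `u`: the sum of any `k` entries of `u` is at most the sum of the first `k` entries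
of `b`, and the total sums agree. This is the usual notion when `b` is antitone; the total sums of
sequences of finite support are encoded as the eventual values of the partial sums. -/
structure Majorizes {R : Type*} [AddCommMonoid R] [LE R] (b u : ℕ → R) : Prop where
  sum_le : ∀ F : Finset ℕ, ∑ i ∈ F, u i ≤ ∑ i ∈ range F.card, b i
  sum_eq : ∀ᶠ n in atTop, ∑ i ∈ range n, u i = ∑ i ∈ range n, b i

namespace Majorizes

section OrderedAddCommMonoid

variable {R : Type*} [AddCommMonoid R] [PartialOrder R] {b b' u u' : ℕ → R}

theorem zero : Majorizes (0 : ℕ → R) 0 := ⟨by simp, by simp⟩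

theorem add [IsOrderedAddMonoid R] (h : Majorizes b u) (h' : Majorizes b' u') :
    Majorizes (b + b') (u + u') where
  sum_le F := by
    simp only [Pi.add_apply, sum_add_distrib]
    exact add_le_add (h.sum_le F) (h'.sum_le F)
  sum_eq := by
    filter_upwards [h.sum_eq, h'.sum_eq] with n hn hn'
    simp only [Pi.add_apply, sum_add_distrib, hn, hn']

theorem permSeq (h : Majorizes b u) {σ : Equiv.Perm ℕ} (hσ : σ ∈ SymInf) :
    Majorizes b (permSeq σ u) where
  sum_le F := by
    rw [sum_permSeq]
    simpa using h.sum_le (F.map (σ⁻¹).toEmbedding)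
  sum_eq := by
    filter_upwards [eventually_sum_range_permSeq hσ u, h.sum_eq] with n hσn hn
    rw [hσn, hn]

theorem refl_of_antitone [IsOrderedAddMonoid R] (hb : Antitone b) : Majorizes b b :=
  ⟨sum_le_sum_range_card_of_antitone hb, .of_forall fun _ => rfl⟩

end OrderedAddCommMonoid

theorem smul {R : Type*} [Semiring R] [PartialOrder R] [IsOrderedRing R] {b u : ℕ → R}
    (h : Majorizes b u) {c : R} (hc : 0 ≤ c) : Majorizes (c • b) (c • u) where
  sum_le F := by
    simp only [Pi.smul_apply, smul_eq_mul, ← mul_sum]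
    exact mul_le_mul_of_nonneg_left (h.sum_le F) hc
  sum_eq := by
    filter_upwards [h.sum_eq] with n hn
    simp only [Pi.smul_apply, ← smul_sum, hn]

end Majorizes

theorem exists_majorizes_of_mem_hull_symOrbit {R : Type*} [Semiring R] [PartialOrder R]
    [IsOrderedRing R] {A : Set (ℕ → R)} (hA : ∀ a ∈ A, Antitone a) {u : ℕ → R}
    (hu : u ∈ PointedCone.hull R (symOrbit A)) :
    ∃ b ∈ PointedCone.hull R A, Majorizes b u := by
  induction hu using Submodule.span_induction with
  | mem x hx =>
    obtain ⟨σ, hσ, a, ha, rfl⟩ := hx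
    exact ⟨a, PointedCone.subset_hull ha, (Majorizes.refl_of_antitone (hA a ha)).permSeq hσ⟩
  | zero => exact ⟨0, zero_mem _, .zero⟩
  | add x y _ _ hx hy =>
    obtain ⟨b, hb, hbx⟩ := hx
    obtain ⟨c, hc, hcy⟩ := hy
    exact ⟨b + c, add_mem hb hc, hbx.add hcy⟩
  | smul c x _ hx =>
    obtain ⟨b, hb, hbx⟩ := hx
    exact ⟨c • b, Submodule.smul_mem _ c hb, hbx.smul c.2⟩

theorem setOf_ne_transfer_ssubset {R : Type*} [AddCommGroup R] [LinearOrder R] {b u : ℕ → R}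
    {j k : ℕ} (hjk : j ≠ k) (hj : u j < b j) (hk : b k < u k) :
    {i | u i ≠ transfer b j k (min (b j - u j) (u k - b k)) i} ⊂ {i | u i ≠ b i} := by
  refine (Set.ssubset_iff_of_subset fun i hi => ?_).2 ?_
  · rintro (hib : u i = b i)
    have hij : i ≠ j := fun h => hj.ne (h ▸ hib)
    have hik : i ≠ k := fun h => hk.ne' (h ▸ hib)
    exact hi (by simpa [transfer_apply, hij, hik] using hib)
  · rcases min_choice (b j - u j) (u k - b k) with h | h
    · exact ⟨j, hj.ne, by simp [transfer_apply, hjk, h]⟩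
    · exact ⟨k, hk.ne', by simp [transfer_apply, hjk.symm, h]⟩

section OrderedRing

variable {R : Type*} [CommRing R] [LinearOrder R] [IsStrictOrderedRing R]

theorem sum_range_le_sum_range_transfer {b u : ℕ → R} {j k : ℕ} {t : R} (hjk : j < k)
    (hbelow : ∀ l < k, u l ≤ b l) (ht : t ≤ b j - u j)
    (hle : ∀ n, ∑ i ∈ range n, u i ≤ ∑ i ∈ range n, b i) (n : ℕ) :
    ∑ i ∈ range n, u i ≤ ∑ i ∈ range n, transfer b j k t i := by
  rw [sum_transfer]
  have hn := hle n
  by_cases hjn : j < n <;> by_cases hkn : k < n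
  · simpa [hjn, hkn] using hn
  · have hsingle : b j - u j ≤ ∑ i ∈ range n, (b i - u i) :=
      single_le_sum (f := fun i => b i - u i)
        (fun i hi => sub_nonneg.2 (hbelow i ((mem_range.1 hi).trans_le (not_lt.1 hkn))))
        (mem_range.2 hjn)
    rw [sum_sub_distrib] at hsingle
    simp only [mem_range, hjn, hkn, if_true, if_false]
    linarith
  · omega
  · simpa [hjn, hkn] using hn

theorem mul_add_le_sum_of_two_mul_le_card {u : ℕ → R} {D : Finset ℕ} {m i j : ℕ} (hm : m ≠ 0)
    (hD : 2 * m ≤ D.card) (hj : j ∈ D) (hj0 : 0 ≤ u j) (hji : u j ≤ u i)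
    (hmin : ∀ l ∈ D, l ≠ j → u i ≤ u l) : m * (u i + u j) ≤ ∑ l ∈ D, u l := by
  have hrest : ((D.erase j).card : R) * u i ≤ ∑ l ∈ D.erase j, u l := by
    rw [← nsmul_eq_mul]
    exact card_nsmul_le_sum _ _ _ fun l hl => hmin l (mem_of_mem_erase hl) (ne_of_mem_erase hl)
  have hcard : 2 * (m : R) ≤ (D.erase j).card + 1 := by
    exact_mod_cast hD.trans_eq (card_erase_add_one hj).symm
  have hone : (1 : R) ≤ m := by exact_mod_cast Nat.one_le_iff_ne_zero.2 hm
  rw [← sum_erase_add _ _ hj]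
  nlinarith

/-- If `H` has fewer than `n` elements, the entries of `u` at `F \ H` have average at least
`(u i + u j) / 2` and number at least `2 * (n - H.card)`; the last `n - H.card` entries of `b`,
which are at most `b H.card`, leave no room for more. -/
theorem Majorizes.sum_add_le_sum_range_card_succ {b u : ℕ → R} {n : ℕ} (hb : Antitone b)
    (hbn : ∀ i ≥ n, b i = 0) (h : Majorizes b u) {F : Finset ℕ} (hF : 2 * n ≤ F.card) {i j : ℕ}
    (hij : i ≠ j) (hj : j ∈ F) (hj0 : 0 ≤ u j) (hji : u j ≤ u i)
    (hmin : ∀ l ∈ F, l ≠ j → u i ≤ u l) {H : Finset ℕ} (hiH : i ∉ H) (hjH : j ∉ H) :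
    ∑ l ∈ H, u l + (u i + u j) ≤ ∑ l ∈ range (H.card + 1), b l := by
  rcases le_or_gt n H.card with hn | hn
  · calc ∑ l ∈ H, u l + (u i + u j) = ∑ l ∈ insert i (insert j H), u l := by
          rw [sum_insert (by simp [hij, hiH]), sum_insert hjH]
          ring
      _ ≤ ∑ l ∈ range n, b l := (h.sum_le _).trans
          (sum_le_sum_range_of_forall_ge_eq_zero (nonneg_of_antitone hb hbn) hbn _)
      _ = ∑ l ∈ range (H.card + 1), b l := (eventually_constant_sum hbn (by omega)).symm
  set q := H.card
  have hcard : 2 * (n - q) ≤ (F \ H).card := by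
    have := le_card_sdiff H F
    omega
  have hone : (1 : R) ≤ (n - q : ℕ) := by exact_mod_cast (by omega : 1 ≤ n - q)
  have hsdiff : (n - q : ℕ) * (u i + u j) ≤ ∑ l ∈ F \ H, u l :=
    mul_add_le_sum_of_two_mul_le_card (by omega) hcard (Finset.mem_sdiff.2 ⟨hj, hjH⟩) hj0 hji
      fun l hl hlj => hmin l (Finset.mem_sdiff.1 hl).1 hlj
  have htotal : ∑ l ∈ H, u l + ∑ l ∈ F \ H, u l ≤ ∑ l ∈ range n, b l := by
    rw [← sum_union disjoint_sdiff]
    exact (h.sum_le _).trans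
      (sum_le_sum_range_of_forall_ge_eq_zero (nonneg_of_antitone hb hbn) hbn _)
  have htail : ∑ l ∈ range n, b l ≤ ∑ l ∈ range q, b l + (n - q : ℕ) * b q := by
    rw [← sum_range_add_sum_Ico _ hn.le]
    have := sum_le_card_nsmul (Ico q n) b (b q) fun l hl => hb (mem_Ico.1 hl).1
    rw [Nat.card_Ico, nsmul_eq_mul] at this
    linarith
  have hH := h.sum_le H
  rw [sum_range_succ]
  nlinarith

theorem Majorizes.merge {b u : ℕ → R} {n : ℕ} (hb : Antitone b) (hbn : ∀ i ≥ n, b i = 0)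
    (h : Majorizes b u) {F : Finset ℕ} (hF : 2 * n ≤ F.card) {i j : ℕ} (hij : i ≠ j)
    (hj : j ∈ F) (hj0 : 0 ≤ u j) (hji : u j ≤ u i)
    (hmin : ∀ l ∈ F, l ≠ j → u i ≤ u l) : Majorizes b (transfer u j i (u j)) where
  sum_le G := by
    rw [sum_transfer]
    by_cases hiG : i ∈ G <;> by_cases hjG : j ∈ G
    · simpa [hiG, hjG] using h.sum_le G
    · have := h.sum_add_le_sum_range_card_succ hb hbn hF hij hj hj0 hji hmin
        (notMem_erase i G) (fun hjG' => hjG (mem_of_mem_erase hjG'))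
      rw [card_erase_add_one hiG, ← add_assoc, sum_erase_add _ _ hiG] at this
      simpa [hiG, hjG] using this
    · simpa [hiG, hjG] using (h.sum_le G).trans (le_add_of_nonneg_right hj0)
    · simpa [hiG, hjG] using h.sum_le G
  sum_eq := by
    filter_upwards [eventually_sum_range_transfer u j i (u j), h.sum_eq] with n hn hn'
    rw [hn, hn']

end OrderedRing

section OrderedField

variable {R : Type*} [Field R] [LinearOrder R] [IsStrictOrderedRing R]

/-- A form of Rado's theorem: transferring to the first entry `k` at which `u` exceeds `b`, from an
earlier entry, makes one more entry of `b` agree with `u`. -/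
theorem mem_of_antitone_of_sum_range_le {C : PointedCone R (ℕ → R)}
    (hC : SymInvariant (C : Set (ℕ → R))) {b u : ℕ → R} (hb : b ∈ C) (hu : Antitone u)
    (hfin : {i | u i ≠ b i}.Finite) (hle : ∀ n, ∑ i ∈ range n, u i ≤ ∑ i ∈ range n, b i)
    (heq : ∀ᶠ n in atTop, ∑ i ∈ range n, u i = ∑ i ∈ range n, b i) : u ∈ C := by
  induction hn : {i | u i ≠ b i}.ncard using Nat.strong_induction_on generalizing b with
  | _ n ih =>
  by_cases hub : ∀ i, u i ≤ b i
  · convert hb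
    ext i
    obtain ⟨N, hN, hiN⟩ := (heq.and (eventually_gt_atTop i)).exists
    exact (sum_eq_sum_iff_of_le fun l _ => hub l).1 hN i (mem_range.2 hiN)
  push Not at hub
  have hbelow : ∀ l < Nat.find hub, u l ≤ b l := fun l hl => not_lt.1 (Nat.find_min hub hl)
  have hk := Nat.find_spec hub
  set k := Nat.find hub
  obtain ⟨j, hjk, hj⟩ : ∃ j ∈ range k, u j < b j := by
    refine exists_lt_of_sum_lt ?_
    have hk1 := hle (k + 1)
    rw [sum_range_succ, sum_range_succ] at hk1
    linarith
  rw [mem_range] at hjk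
  have hlt := setOf_ne_transfer_ssubset hjk.ne hj hk
  set t := min (b j - u j) (u k - b k)
  have htj : t ≤ b j - u j := min_le_left _ _
  have htk : t ≤ u k - b k := min_le_right _ _
  have ht : 0 < t := lt_min (sub_pos.2 hj) (sub_pos.2 hk)
  have hbt : transfer b j k t ∈ C :=
    transfer_mem_of_symInvariant hC hb ht.le (by linarith [hu hjk.le, htj, htk])
  refine ih _ (hn ▸ Set.ncard_lt_ncard hlt hfin) hbt (hfin.subset hlt.subset)
    (sum_range_le_sum_range_transfer hjk hbelow htj hle) ?_ rfl
  filter_upwards [heq, eventually_sum_range_transfer b j k t] with n h h'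
  rw [h, h']

theorem Majorizes.mem {C : PointedCone R (ℕ → R)} (hC : SymInvariant (C : Set (ℕ → R)))
    {b u : ℕ → R} (h : Majorizes b u) (hb : b ∈ C) (hbfin : b ∈ FinSuppSeq R)
    (hufin : u ∈ FinSuppSeq R) (hu : ∀ i, 0 ≤ u i) : u ∈ C := by
  obtain ⟨σ, hσ, hanti⟩ := exists_symInf_antitone_permSeq hufin hu
  have hσu := h.permSeq hσ
  refine (hC.permSeq_mem_iff hσ).1 (mem_of_antitone_of_sum_range_le hC hb hanti ?_
    (fun n => by simpa using hσu.sum_le (range n)) hσu.sum_eq)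
  refine (Set.Finite.union (permSeq_mem_finSuppSeq hufin σ) hbfin).subset fun i hi => ?_
  contrapose! hi
  simp_all

end OrderedField

/-! ### Integral generators -/

theorem intSeqToReal_apply (u : ℕ → ℤ) (i : ℕ) : intSeqToReal u i = u i := rfl

theorem intSeqToReal_transfer (u : ℕ → ℤ) (i j : ℕ) (t : ℤ) :
    intSeqToReal (transfer u i j t) = transfer (intSeqToReal u) i j t := by
  ext l
  simp [intSeqToReal_apply, transfer_apply]

theorem symOrbit_intSeqToReal_image (Z : Set (ℕ → ℤ)) :
    symOrbit (intSeqToReal '' Z) = intSeqToReal '' symOrbit Z := by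
  ext u
  constructor
  · rintro ⟨σ, hσ, _, ⟨z, hz, rfl⟩, rfl⟩
    exact ⟨permSeq σ z, ⟨σ, hσ, z, hz, rfl⟩, rfl⟩
  · rintro ⟨_, ⟨σ, hσ, z, hz, rfl⟩, rfl⟩
    exact ⟨σ, hσ, intSeqToReal z, ⟨z, hz, rfl⟩, rfl⟩

theorem intSeqToReal_mem_finSuppSeq_iff {u : ℕ → ℤ} :
    intSeqToReal u ∈ FinSuppSeq ℝ ↔ u ∈ FinSuppSeq ℤ := by
  have : Function.support (intSeqToReal u) = Function.support u := by
    ext i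
    simp [intSeqToReal_apply]
  exact iff_of_eq (congrArg Set.Finite this)

theorem antitone_intSeqToReal_iff {u : ℕ → ℤ} : Antitone (intSeqToReal u) ↔ Antitone u := by
  simp only [Antitone, intSeqToReal_apply, Int.cast_le]

theorem exists_intSeqToReal_eq_smul {b : ℕ → ℝ} (hb : b ∈ FinSuppSeq ℝ)
    (hq : ∀ i, ∃ q : ℚ, b i = q) : ∃ z : ℕ → ℤ, ∃ c : ℝ, 0 < c ∧ intSeqToReal z = c • b := by
  choose q hq using hq
  have hb' : (Function.support b).Finite := hb
  obtain ⟨d, hd⟩ := IsLocalization.exist_integer_multiples (nonZeroDivisors ℤ) hb'.toFinset q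
  have hd0 : (d : ℝ) ≠ 0 := Int.cast_ne_zero.2 (nonZeroDivisors.coe_ne_zero d)
  have hz : ∀ i, ∃ z : ℤ, (z : ℝ) = d * b i := by
    intro i
    by_cases hi : b i = 0
    · exact ⟨0, by simp [hi]⟩
    obtain ⟨z, hz⟩ := hd i (hb'.mem_toFinset.2 hi)
    refine ⟨z, ?_⟩
    rw [hq i]
    simpa [zsmul_eq_mul] using congrArg (Rat.cast : ℚ → ℝ) hz
  choose z hz using hz
  refine ⟨fun i => d * z i, d ^ 2, by positivity, ?_⟩
  ext i
  simp only [intSeqToReal_apply, Int.cast_mul, hz, Pi.smul_apply, smul_eq_mul]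
  ring

theorem exists_antitone_intSeqToReal_eq_smul_permSeq {b : ℕ → ℝ} (hb : b ∈ FinSuppSeq ℝ)
    (hq : ∀ i, ∃ q : ℚ, b i = q) (hb0 : ∀ i, 0 ≤ b i) :
    ∃ z ∈ FinSuppSeq ℤ, Antitone z ∧ ∃ c : ℝ, 0 < c ∧ ∃ σ ∈ SymInf,
      intSeqToReal z = c • permSeq σ b := by
  obtain ⟨σ, hσ, hanti⟩ := exists_symInf_antitone_permSeq hb hb0
  have hσb := permSeq_mem_finSuppSeq hb σ
  obtain ⟨z, c, hc, hz⟩ := exists_intSeqToReal_eq_smul hσb fun i => hq (σ⁻¹ i)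
  refine ⟨z, ?_, ?_, c, hc, σ, hσ, hz⟩
  · rw [← intSeqToReal_mem_finSuppSeq_iff, hz]
    exact hσb.subset (Function.support_const_smul_subset c _)
  · rw [← antitone_intSeqToReal_iff, hz]
    exact hanti.const_smul hc.le

theorem exists_finite_antitone_hull_symOrbit_eq {C : PointedCone ℝ (ℕ → ℝ)}
    (hfin : (C : Set (ℕ → ℝ)) ⊆ FinSuppSeq ℝ) (hnonneg : ∀ u ∈ C, ∀ i, 0 ≤ u i)
    (hfg : ConeSymFG C) (hrat : ConeRational C) :
    ∃ Z : Set (ℕ → ℤ), Z.Finite ∧ Z ⊆ FinSuppSeq ℤ ∧ (∀ z ∈ Z, Antitone z) ∧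
      C = PointedCone.hull ℝ (symOrbit (intSeqToReal '' Z)) := by
  obtain ⟨A, hA, -, hCA⟩ := hfg
  obtain ⟨B, hB, hCB⟩ := hrat
  have hCinv : SymInvariant (C : Set (ℕ → ℝ)) := hCA ▸ symInvariant_hull_symOrbit A
  have hBC : B ⊆ C := hCB ▸ PointedCone.subset_hull
  have hAC : A ⊆ C := hCA ▸ (subset_symOrbit A).trans PointedCone.subset_hull
  lift A to Finset (ℕ → ℝ) using hA
  obtain ⟨T, hTB, hAT⟩ := Submodule.subset_span_finite_of_subset_span
    (show (A : Set (ℕ → ℝ)) ⊆ PointedCone.hull ℝ B from hCB ▸ hAC)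
  have hT : ∀ b ∈ T, ∃ z ∈ FinSuppSeq ℤ, Antitone z ∧ ∃ c : ℝ, 0 < c ∧ ∃ σ ∈ SymInf,
      intSeqToReal z = c • permSeq σ b := fun b hb =>
    exists_antitone_intSeqToReal_eq_smul_permSeq (hfin (hBC (hTB hb))) (hB b (hTB hb))
      (hnonneg b (hBC (hTB hb)))
  choose! z hzfin hanti c hc σ hσ hz using hT
  refine ⟨z '' T, T.finite_toSet.image z, Set.image_subset_iff.2 hzfin,
    Set.forall_mem_image.2 hanti, le_antisymm ?_ ?_⟩
  · set D := PointedCone.hull ℝ (symOrbit (intSeqToReal '' (z '' T)))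
    have hDinv : SymInvariant (D : Set (ℕ → ℝ)) := symInvariant_hull_symOrbit _
    have hTD : (T : Set (ℕ → ℝ)) ⊆ D := fun b hb => by
      have hzD : intSeqToReal (z b) ∈ D :=
        PointedCone.subset_hull (subset_symOrbit _ ⟨z b, ⟨b, hb, rfl⟩, rfl⟩)
      rw [← hDinv.permSeq_mem_iff (hσ b hb),
        ← inv_smul_smul₀ (hc b hb).ne' (permSeq (σ b) b), ← hz b hb]
      exact D.smul_mem (inv_nonneg.2 (hc b hb).le) hzD
    rw [hCA, hDinv.hull_symOrbit_le_iff]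
    exact hAT.trans (Submodule.span_le.2 hTD)
  · refine hCinv.hull_symOrbit_le_iff.2 ?_
    rintro _ ⟨_, ⟨b, hb, rfl⟩, rfl⟩
    rw [hz b hb]
    exact C.smul_mem (hc b hb).le (hCinv _ (hσ b hb) _ (hBC (hTB hb)))

/-! ### Lattice points -/

theorem mem_latticePoints {C : PointedCone ℝ (ℕ → ℝ)} {u : ℕ → ℤ} :
    u ∈ latticePoints C ↔ intSeqToReal u ∈ C ∧ u ∈ FinSuppSeq ℤ := Iff.rfl

theorem monoidNormal_latticePoints (C : PointedCone ℝ (ℕ → ℝ)) :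
    MonoidNormal (latticePoints C) := by
  ext u
  refine ⟨fun h => ⟨1, le_rfl, by simpa using h⟩, ?_⟩
  rintro ⟨k, hk, hku⟩
  obtain ⟨hkC, hkfin⟩ := mem_latticePoints.1 hku
  have hk0 : k ≠ 0 := Nat.one_le_iff_ne_zero.1 hk
  refine mem_latticePoints.2 ⟨?_, ?_⟩
  · rw [map_nsmul, ← Nat.cast_smul_eq_nsmul ℝ] at hkC
    rw [← inv_smul_smul₀ (Nat.cast_ne_zero.2 hk0 : (k : ℝ) ≠ 0) (intSeqToReal u)]
    exact C.smul_mem (by positivity) hkC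
  · refine Set.Finite.subset hkfin fun i hi => ?_
    simpa [hk0] using hi

theorem nonneg_of_mem_latticePoints {C : PointedCone ℝ (ℕ → ℝ)}
    (hnonneg : ∀ u ∈ C, ∀ i, 0 ≤ u i) {u : ℕ → ℤ} (hu : u ∈ latticePoints C) (i : ℕ) : 0 ≤ u i :=
  Int.cast_nonneg_iff.1 (hnonneg _ hu.1 i)

theorem symInvariant_latticePoints {C : PointedCone ℝ (ℕ → ℝ)}
    (hC : SymInvariant (C : Set (ℕ → ℝ))) : SymInvariant (latticePoints C : Set (ℕ → ℤ)) :=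
  fun σ hσ u hu => ⟨hC σ hσ (intSeqToReal u) hu.1, permSeq_mem_finSuppSeq hu.2 σ⟩

/-- The lattice points of `C` with coordinate sum at most `L`, the sum being controlled through its
finite partial sums; for large `L` they generate the monoid of lattice points. -/
def boundedLatticePoints (C : PointedCone ℝ (ℕ → ℝ)) (L : ℕ) : Set (ℕ → ℤ) :=
  {g | g ∈ latticePoints C ∧ ∀ F : Finset ℕ, ∑ i ∈ F, g i ≤ L}

theorem symInvariant_boundedLatticePoints {C : PointedCone ℝ (ℕ → ℝ)}
    (hC : SymInvariant (C : Set (ℕ → ℝ))) (L : ℕ) : SymInvariant (boundedLatticePoints C L) :=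
  fun σ hσ g hg => ⟨symInvariant_latticePoints hC σ hσ g hg.1, fun F => by
    rw [sum_permSeq]
    exact hg.2 _⟩

theorem transfer_mem_boundedLatticePoints {C : PointedCone ℝ (ℕ → ℝ)}
    (hnonneg : ∀ u ∈ C, ∀ i, 0 ≤ u i) (hC : SymInvariant (C : Set (ℕ → ℝ))) {L : ℕ} {g : ℕ → ℤ}
    (hg : g ∈ boundedLatticePoints C L) {i j : ℕ} (hij : g j < g i) :
    transfer g i j 1 ∈ boundedLatticePoints C L := by
  refine ⟨⟨?_, transfer_mem_finSuppSeq hg.1.2 i j 1⟩, fun F => ?_⟩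
  · change intSeqToReal (transfer g i j 1) ∈ C
    rw [intSeqToReal_transfer]
    refine transfer_mem_of_symInvariant hC hg.1.1 (by simp) ?_
    simp only [intSeqToReal_apply]
    exact_mod_cast Int.le_sub_right_of_add_le (by omega)
  · have hF := hg.2 F
    have hiF := hg.2 (insert i F)
    have hj0 := nonneg_of_mem_latticePoints hnonneg hg.1 j
    rw [sum_transfer]
    by_cases hi : i ∈ F
    · split_ifs <;> omega
    · rw [sum_insert hi] at hiF
      split_ifs <;> omega

theorem transfer_one_mem_closure {C : PointedCone ℝ (ℕ → ℝ)}
    (hnonneg : ∀ u ∈ C, ∀ i, 0 ≤ u i) (hC : SymInvariant (C : Set (ℕ → ℝ))) {L : ℕ} {u : ℕ → ℤ}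
    (hu : u ∈ AddSubmonoid.closure (boundedLatticePoints C L)) {i j : ℕ} (hij : u j < u i) :
    transfer u i j 1 ∈ AddSubmonoid.closure (boundedLatticePoints C L) := by
  induction hu using AddSubmonoid.closure_induction with
  | zero => exact absurd hij (lt_irrefl _)
  | mem g hg =>
    exact AddSubmonoid.subset_closure (transfer_mem_boundedLatticePoints hnonneg hC hg hij)
  | add x y hx hy ihx ihy =>
    by_cases hxij : x j < x i
    · rw [transfer, add_right_comm]
      exact add_mem (ihx hxij) hy
    · rw [transfer, add_assoc]
      refine add_mem hx (ihy ?_)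
      simp only [Pi.add_apply] at hij
      omega

theorem transfer_natCast_mem_closure {C : PointedCone ℝ (ℕ → ℝ)}
    (hnonneg : ∀ u ∈ C, ∀ i, 0 ≤ u i) (hC : SymInvariant (C : Set (ℕ → ℝ))) {L : ℕ} {u : ℕ → ℤ}
    (hu : u ∈ AddSubmonoid.closure (boundedLatticePoints C L)) {i j : ℕ} {c : ℕ}
    (hc : 2 * c ≤ u i - u j) :
    transfer u i j c ∈ AddSubmonoid.closure (boundedLatticePoints C L) := by
  induction c with
  | zero => simpa [transfer] using hu
  | succ c ih =>
    rw [Nat.cast_succ, ← transfer_transfer]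
    refine transfer_one_mem_closure hnonneg hC (ih (by omega)) ?_
    have hij : i ≠ j := by
      rintro rfl
      omega
    simp only [transfer_apply, hij, hij.symm, if_true, if_false]
    omega

/-! ### Gordan's argument for bounded support -/

/-- The lattice points of the zonotope `∑ x ∈ T, [0, 1] x`: the remainders in Gordan's argument. -/
def latticeZonotope (T : Finset (ℕ → ℤ)) : Set (ℕ → ℤ) :=
  {w | ∃ μ : (ℕ → ℤ) → ℝ, (∀ x, 0 ≤ μ x ∧ μ x ≤ 1) ∧
    intSeqToReal w = ∑ x ∈ T, μ x • intSeqToReal x}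

theorem subset_latticeZonotope (T : Finset (ℕ → ℤ)) : ↑T ⊆ latticeZonotope T := by
  classical
  refine fun x hx => ⟨fun y => if y = x then 1 else 0, fun y => ?_, ?_⟩
  · dsimp only
    split_ifs <;> simp
  · simpa using fun h : x ∉ T => absurd hx h

theorem mem_closure_latticeZonotope {T : Finset (ℕ → ℤ)} {u : ℕ → ℤ}
    (hu : intSeqToReal u ∈ PointedCone.hull ℝ (intSeqToReal '' T)) :
    u ∈ AddSubmonoid.closure (latticeZonotope T) := by
  obtain ⟨c, hc⟩ := (Submodule.mem_span_image_finset_iff_exists_fun' _).1 hu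
  set w : ℕ → ℤ := u - ∑ x ∈ T, ⌊(c x : ℝ)⌋₊ • x with hw
  have hwT : w ∈ latticeZonotope T := by
    refine ⟨fun x => c x - ⌊(c x : ℝ)⌋₊, fun x => ⟨?_, ?_⟩, ?_⟩
    · exact sub_nonneg.2 (Nat.floor_le (c x).2)
    · exact (sub_lt_iff_lt_add'.2 (Nat.lt_floor_add_one _)).le
    · simp only [hw, map_sub, map_sum, map_nsmul, ← hc, sub_smul, sum_sub_distrib,
        Nat.cast_smul_eq_nsmul]
      rfl
  rw [← sub_add_cancel u (∑ x ∈ T, ⌊(c x : ℝ)⌋₊ • x), ← hw]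
  exact add_mem (AddSubmonoid.subset_closure hwT) (sum_mem fun x hx =>
    nsmul_mem (AddSubmonoid.subset_closure (subset_latticeZonotope T hx)) _)

theorem sum_le_of_mem_latticeZonotope {T : Finset (ℕ → ℤ)} (hT : ∀ x ∈ T, ∀ i, 0 ≤ x i)
    {w : ℕ → ℤ} (hw : w ∈ latticeZonotope T) (F : Finset ℕ) :
    ∑ i ∈ F, w i ≤ ∑ x ∈ T, ∑ i ∈ F, x i := by
  obtain ⟨μ, hμ, hwμ⟩ := hw
  rw [← Int.cast_le (R := ℝ)]
  calc ((∑ i ∈ F, w i : ℤ) : ℝ) = ∑ i ∈ F, ∑ x ∈ T, μ x * x i := by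
        rw [Int.cast_sum]
        refine sum_congr rfl fun i _ => ?_
        simpa [intSeqToReal_apply] using congrFun hwμ i
    _ = ∑ x ∈ T, μ x * ∑ i ∈ F, (x i : ℝ) := by rw [sum_comm]; simp only [mul_sum]
    _ ≤ ∑ x ∈ T, ∑ i ∈ F, (x i : ℝ) := sum_le_sum fun x hx => mul_le_of_le_one_left
        (sum_nonneg fun i _ => Int.cast_nonneg (hT x hx i)) (hμ x).2
    _ = _ := by push_cast; rfl

theorem latticeZonotope_subset_boundedLatticePoints {C : PointedCone ℝ (ℕ → ℝ)}
    (hnonneg : ∀ u ∈ C, ∀ i, 0 ≤ u i) {T : Finset (ℕ → ℤ)}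
    (hT : (T : Set (ℕ → ℤ)) ⊆ latticePoints C) {K : ℕ} (hTK : ∀ x ∈ T, ∀ l ≥ K, x l = 0) :
    latticeZonotope T ⊆ boundedLatticePoints C (∑ x ∈ T, ∑ l ∈ range K, x l).toNat := by
  have hT0 : ∀ x ∈ T, ∀ i, 0 ≤ x i := fun x hx => nonneg_of_mem_latticePoints hnonneg (hT hx)
  refine fun w hw => ⟨⟨?_, ?_⟩, fun F => ?_⟩
  · obtain ⟨μ, hμ, hwμ⟩ := hw
    change intSeqToReal w ∈ C
    rw [hwμ]
    exact sum_mem fun x hx => C.smul_mem (hμ x).1 (hT hx).1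
  · obtain ⟨μ, -, hwμ⟩ := hw
    rw [SetLike.mem_coe, ← intSeqToReal_mem_finSuppSeq_iff, hwμ]
    refine mem_finSuppSeq_of_forall_ge_eq_zero (N := K) fun l hl => ?_
    rw [Finset.sum_apply]
    exact sum_eq_zero fun x hx => by simp [intSeqToReal_apply, hTK x hx l hl]
  · rw [Int.toNat_of_nonneg (sum_nonneg fun x hx => sum_nonneg fun l _ => hT0 x hx l)]
    exact (sum_le_of_mem_latticeZonotope hT0 hw F).trans
      (sum_le_sum fun x hx => sum_le_sum_range_of_forall_ge_eq_zero (hT0 x hx) (hTK x hx) F)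

theorem exists_forall_mem_closure_of_forall_ge_eq_zero {Z : Set (ℕ → ℤ)} (hZ : Z.Finite)
    (hZfin : Z ⊆ FinSuppSeq ℤ) {C : PointedCone ℝ (ℕ → ℝ)}
    (hC : C = PointedCone.hull ℝ (symOrbit (intSeqToReal '' Z)))
    (hnonneg : ∀ u ∈ C, ∀ i, 0 ≤ u i) (K : ℕ) :
    ∃ L : ℕ, ∀ u ∈ latticePoints C, (∀ l ≥ K, u l = 0) →
      u ∈ AddSubmonoid.closure (boundedLatticePoints C L) := by
  have hsub : intSeqToReal '' symOrbit Z ⊆ C := by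
    rw [hC, symOrbit_intSeqToReal_image]
    exact PointedCone.subset_hull
  set T := (finite_setOf_mem_symOrbit_forall_ge_eq_zero hZ hZfin K).toFinset with hTdef
  have hT {x : ℕ → ℤ} : x ∈ T ↔ x ∈ symOrbit Z ∧ ∀ l ≥ K, x l = 0 := by simp [hTdef]
  have hTC : (T : Set (ℕ → ℤ)) ⊆ latticePoints C := fun x hx =>
    ⟨hsub ⟨x, (hT.1 hx).1, rfl⟩, mem_finSuppSeq_of_forall_ge_eq_zero (hT.1 hx).2⟩
  refine ⟨_, fun u hu huK => AddSubmonoid.closure_mono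
    (latticeZonotope_subset_boundedLatticePoints hnonneg hTC fun x hx => (hT.1 hx).2)
    (mem_closure_latticeZonotope ?_)⟩
  have huC : intSeqToReal u ∈ PointedCone.hull ℝ (intSeqToReal '' symOrbit Z) := by
    rw [← symOrbit_intSeqToReal_image, ← hC]
    exact hu.1
  refine Submodule.span_mono ?_ (mem_hull_setOf_eq_zero (I := Set.Ici K)
    (fun x hx => hnonneg x (hsub hx)) huC fun l hl => by simp [intSeqToReal_apply, huK l hl])
  rintro _ ⟨⟨x, hx, rfl⟩, hxK⟩
  exact ⟨x, hT.2 ⟨hx, fun l hl => Int.cast_eq_zero.1 (hxK l hl)⟩, rfl⟩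

/-! ### Reduction to bounded support -/

theorem merge_mem_hull_symOrbit {R : Type*} [Field R] [LinearOrder R] [IsStrictOrderedRing R]
    {A : Set (ℕ → R)} {n : ℕ} (hA : ∀ a ∈ A, Antitone a) (hAn : ∀ a ∈ A, ∀ l ≥ n, a l = 0)
    {u : ℕ → R} (hu : u ∈ PointedCone.hull R (symOrbit A)) (hufin : u ∈ FinSuppSeq R)
    (hu0 : ∀ i, 0 ≤ u i) {F : Finset ℕ} (hF : 2 * n ≤ F.card) {i j : ℕ} (hij : i ≠ j)
    (hj : j ∈ F) (hji : u j ≤ u i) (hmin : ∀ l ∈ F, l ≠ j → u i ≤ u l) :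
    transfer u j i (u j) ∈ PointedCone.hull R (symOrbit A) := by
  obtain ⟨b, hbA, hbu⟩ := exists_majorizes_of_mem_hull_symOrbit hA hu
  have hb := antitone_of_mem_hull hA hbA
  have hbn : ∀ l ≥ n, b l = 0 := fun l hl => eq_zero_of_mem_hull (fun a ha => hAn a ha l hl) hbA
  refine (hbu.merge hb hbn hF hij hj (hu0 j) hji hmin).mem (symInvariant_hull_symOrbit A)
    (Submodule.span_mono (subset_symOrbit A) hbA) (mem_finSuppSeq_of_forall_ge_eq_zero hbn)
    (transfer_mem_finSuppSeq hufin j i (u j)) fun l => ?_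
  rw [transfer_apply]
  have hl := hu0 l
  have hj0 := hu0 j
  split_ifs with hli hlj hlj
  · linarith
  · linarith
  · simp [hlj]
  · simpa using hl

theorem exists_two_smallest {α β : Type*} [LinearOrder β] (u : α → β) {F : Finset α}
    (hF : 1 < F.card) :
    ∃ j ∈ F, ∃ i ∈ F, i ≠ j ∧ u j ≤ u i ∧ ∀ l ∈ F, l ≠ j → u i ≤ u l := by
  classical
  obtain ⟨j, hj, hjmin⟩ := F.exists_min_image u (card_pos.1 (zero_lt_one.trans hF))
  obtain ⟨i, hi, himin⟩ := (F.erase j).exists_min_image u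
    (card_pos.1 (by rw [card_erase_of_mem hj]; omega))
  exact ⟨j, hj, i, mem_of_mem_erase hi, ne_of_mem_erase hi, hjmin i (mem_of_mem_erase hi),
    fun l hl hlj => himin l (mem_erase.2 ⟨hlj, hl⟩)⟩

theorem exists_transfer_mem_latticePoints {Z : Set (ℕ → ℤ)} {n : ℕ} (hanti : ∀ z ∈ Z, Antitone z)
    (hZn : ∀ z ∈ Z, ∀ l ≥ n, z l = 0) {C : PointedCone ℝ (ℕ → ℝ)}
    (hC : C = PointedCone.hull ℝ (symOrbit (intSeqToReal '' Z))) (hnonneg : ∀ u ∈ C, ∀ i, 0 ≤ u i)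
    {u : ℕ → ℤ} (hu : u ∈ latticePoints C) (hcard : 2 * n + 1 < (Function.support u).ncard) :
    ∃ i j, i ≠ j ∧ u i ≠ 0 ∧ u j ≠ 0 ∧ u j ≤ u i ∧ transfer u j i (u j) ∈ latticePoints C := by
  obtain ⟨huC, hufin⟩ := mem_latticePoints.1 hu
  have hufin' : (Function.support u).Finite := hufin
  rw [Set.ncard_eq_toFinset_card _ hufin'] at hcard
  obtain ⟨j, hj, i, hi, hij, hji, hmin⟩ :=
    exists_two_smallest (intSeqToReal u) (by omega : 1 < hufin'.toFinset.card)
  refine ⟨i, j, hij, hufin'.mem_toFinset.1 hi, hufin'.mem_toFinset.1 hj, Int.cast_le.1 hji,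
    mem_latticePoints.2 ⟨?_, transfer_mem_finSuppSeq hufin j i (u j)⟩⟩
  have huC0 := hnonneg _ huC
  rw [hC] at huC ⊢
  rw [intSeqToReal_transfer]
  exact merge_mem_hull_symOrbit (n := n)
    (Set.forall_mem_image.2 fun z hz => antitone_intSeqToReal_iff.2 (hanti z hz))
    (Set.forall_mem_image.2 fun z hz l hl => by simp [intSeqToReal_apply, hZn z hz l hl]) huC
    (intSeqToReal_mem_finSuppSeq_iff.2 hufin) huC0 (by omega) hij hj hji hmin

theorem mem_closure_of_transfer_mem_closure {C : PointedCone ℝ (ℕ → ℝ)}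
    (hnonneg : ∀ u ∈ C, ∀ i, 0 ≤ u i) (hC : SymInvariant (C : Set (ℕ → ℝ))) {L : ℕ} {u : ℕ → ℤ}
    {i j : ℕ} (hij : i ≠ j) (hj : 0 ≤ u j) (hji : u j ≤ u i)
    (hu : transfer u j i (u j) ∈ AddSubmonoid.closure (boundedLatticePoints C L)) :
    u ∈ AddSubmonoid.closure (boundedLatticePoints C L) := by
  rw [← transfer_transfer_symm u j i (u j), ← Int.toNat_of_nonneg hj]
  rw [← Int.toNat_of_nonneg hj] at hu
  refine transfer_natCast_mem_closure hnonneg hC hu ?_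
  simp only [transfer_apply, hij, hij.symm, if_true, if_false]
  omega

theorem support_transfer_ssubset {R : Type*} [AddCommGroup R] {u : ℕ → R} {i j : ℕ} (hij : i ≠ j)
    (hi : u i ≠ 0) (hj : u j ≠ 0) :
    Function.support (transfer u j i (u j)) ⊂ Function.support u := by
  refine (Set.ssubset_iff_of_subset fun l hl => ?_).2 ⟨j, hj, ?_⟩
  · rintro (hl0 : u l = 0)
    have hli : l ≠ i := fun h => hi (h ▸ hl0)
    have hlj : l ≠ j := fun h => hj (h ▸ hl0)
    exact hl (by simp [transfer_apply, hli, hlj, hl0])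
  · simp [transfer_apply, hij.symm]

theorem mem_closure_of_ncard_support_le {C : PointedCone ℝ (ℕ → ℝ)}
    (hnonneg : ∀ u ∈ C, ∀ i, 0 ≤ u i) (hC : SymInvariant (C : Set (ℕ → ℝ))) {K L : ℕ}
    (hsmall : ∀ u ∈ latticePoints C, (∀ l ≥ K, u l = 0) →
      u ∈ AddSubmonoid.closure (boundedLatticePoints C L))
    {u : ℕ → ℤ} (hu : u ∈ latticePoints C) (hK : (Function.support u).ncard ≤ K) :
    u ∈ AddSubmonoid.closure (boundedLatticePoints C L) := by
  obtain ⟨σ, hσ, hanti⟩ :=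
    exists_symInf_antitone_permSeq hu.2 (nonneg_of_mem_latticePoints hnonneg hu)
  have hσu := symInvariant_latticePoints hC σ hσ u hu
  have hinv := symInvariant_closure (symInvariant_boundedLatticePoints hC L)
  refine (hinv.permSeq_mem_iff hσ).1 (hsmall _ hσu fun l hl => ?_)
  exact eq_zero_of_antitone_of_ncard_support_le hanti (nonneg_of_mem_latticePoints hnonneg hσu)
    hσu.2 ((ncard_support_permSeq σ u).trans_le hK) hl

theorem latticePoints_le_closure_boundedLatticePoints {C : PointedCone ℝ (ℕ → ℝ)}
    (hnonneg : ∀ u ∈ C, ∀ i, 0 ≤ u i) (hC : SymInvariant (C : Set (ℕ → ℝ))) {K L : ℕ}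
    (hsmall : ∀ u ∈ latticePoints C, (∀ l ≥ K, u l = 0) →
      u ∈ AddSubmonoid.closure (boundedLatticePoints C L))
    (hmerge : ∀ u ∈ latticePoints C, K < (Function.support u).ncard →
      ∃ i j, i ≠ j ∧ u i ≠ 0 ∧ u j ≠ 0 ∧ u j ≤ u i ∧ transfer u j i (u j) ∈ latticePoints C) :
    latticePoints C ≤ AddSubmonoid.closure (boundedLatticePoints C L) := by
  intro u hu
  induction hn : (Function.support u).ncard using Nat.strong_induction_on generalizing u with
  | _ n ih =>
  rcases le_or_gt (Function.support u).ncard K with hK | hK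
  · exact mem_closure_of_ncard_support_le hnonneg hC hsmall hu hK
  obtain ⟨i, j, hij, hi, hj, hji, hv⟩ := hmerge u hu hK
  have hlt := Set.ncard_lt_ncard (support_transfer_ssubset hij hi hj) hu.2
  exact mem_closure_of_transfer_mem_closure hnonneg hC hij
    (nonneg_of_mem_latticePoints hnonneg hu j) hji (ih _ (hn ▸ hlt) hv rfl)

theorem ncard_support_le_of_mem_boundedLatticePoints {C : PointedCone ℝ (ℕ → ℝ)}
    (hnonneg : ∀ u ∈ C, ∀ i, 0 ≤ u i) {L : ℕ} {g : ℕ → ℤ} (hg : g ∈ boundedLatticePoints C L) :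
    (Function.support g).ncard ≤ L := by
  have hgfin : (Function.support g).Finite := hg.1.2
  rw [Set.ncard_eq_toFinset_card _ hgfin]
  have h := card_nsmul_le_sum hgfin.toFinset g 1 fun i hi => by
    have := nonneg_of_mem_latticePoints hnonneg hg.1 i
    have : g i ≠ 0 := hgfin.mem_toFinset.1 hi
    omega
  rw [nsmul_one] at h
  exact_mod_cast h.trans (hg.2 _)

theorem monoidSymFG_latticePoints_of_le_closure {C : PointedCone ℝ (ℕ → ℝ)}
    (hnonneg : ∀ u ∈ C, ∀ i, 0 ≤ u i) (hC : SymInvariant (C : Set (ℕ → ℝ))) {L : ℕ}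
    (hL : latticePoints C ≤ AddSubmonoid.closure (boundedLatticePoints C L)) :
    MonoidSymFG (latticePoints C) := by
  have hnonneg' {g} (hg : g ∈ boundedLatticePoints C L) : ∀ i, 0 ≤ g i :=
    nonneg_of_mem_latticePoints hnonneg hg.1
  refine ⟨{g ∈ boundedLatticePoints C L | Antitone g}, ?_, fun g hg => hg.1.1.2, le_antisymm ?_ ?_⟩
  · refine (finite_setOf_forall_ge_eq_zero (Set.finite_Icc (0 : ℤ) L) L).subset ?_
    rintro g ⟨hg, hanti⟩
    refine ⟨fun l => ⟨hnonneg' hg l, by simpa using hg.2 {l}⟩, fun l hl => ?_⟩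
    exact eq_zero_of_antitone_of_ncard_support_le hanti (hnonneg' hg) hg.1.2
      (ncard_support_le_of_mem_boundedLatticePoints hnonneg hg) hl
  · refine hL.trans (AddSubmonoid.closure_mono fun g hg => ?_)
    obtain ⟨σ, hσ, hanti⟩ := exists_symInf_antitone_permSeq hg.1.2 (hnonneg' hg)
    exact ⟨σ⁻¹, inv_mem hσ, permSeq σ g, ⟨symInvariant_boundedLatticePoints hC L σ hσ g hg, hanti⟩,
      (permSeq_inv_permSeq σ g).symm⟩
  · exact AddSubmonoid.closure_le.2
      ((symInvariant_latticePoints hC).symOrbit_subset_iff.2 fun g hg => hg.1.1)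

theorem mainTheorem1 (C : PointedCone ℝ (ℕ → ℝ))
    (hfin : (C : Set (ℕ → ℝ)) ⊆ FinSuppSeq ℝ)
    (hnonneg : ∀ u ∈ C, ∀ i, 0 ≤ u i)
    (hfg : ConeSymFG C) (hrat : ConeRational C) :
    MonoidNormal (latticePoints C) ∧ MonoidSymFG (latticePoints C) := by
  refine ⟨monoidNormal_latticePoints C, ?_⟩
  obtain ⟨Z, hZ, hZfin, hanti, hCZ⟩ :=
    exists_finite_antitone_hull_symOrbit_eq hfin hnonneg hfg hrat
  obtain ⟨n, hn⟩ := exists_forall_ge_eq_zero_of_finite hZ hZfin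
  have hC : SymInvariant (C : Set (ℕ → ℝ)) := hCZ ▸ symInvariant_hull_symOrbit _
  obtain ⟨L, hL⟩ :=
    exists_forall_mem_closure_of_forall_ge_eq_zero hZ hZfin hCZ hnonneg (2 * n + 1)
  exact monoidSymFG_latticePoints_of_le_closure hnonneg hC
    (latticePoints_le_closure_boundedLatticePoints hnonneg hC hL fun u hu hcard =>
      exists_transfer_mem_latticePoints hanti hn hCZ hnonneg hu hcard)
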